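/- Conventions. Identify $\mathbf R^2$ with $\mathbf C$ and write $x^\perp=(-x_2,x_1)$. A shape is a compact simply connected set $\mathcal S_0\subset\mathbf R^2$ with connected complement and smooth boundary (near each boundary point, $\mathcal S_0$ is $\{g\le0\}$ for a smooth real function $g$ vanishing at that point with nonzero gradient). A position $\mathbf p$ of the solid of shape $\mathcal S_0$ is a triplet $(\theta,\mathbf s,\mathbf r)\in\mathbf R/2\pi\times\mathbf R^2\times\mathbf R^2$, acting by $\mathbf p x=R(\theta)(x-\mathbf s)+\mathbf r$, where $R(\theta)$ is the rotation of angle $\theta$; two triplets define the same position if they give the same solid $\mathbf p(\mathcal S_0)$. A rigid velocity is a field $\mathbf v(x)=\omega(x-\mathbf s)^\perp+\mathbf w$ with $\omega\in\mathbf R$ and $\mathbf s,\mathbf w\in\mathbf R^2$. A configuration is a pair $(\mathbf p,\mathbf v)$ of a position and a rigid velocity. The fluid potential of the configuration $(\mathbf p,\mathbf v)$ is the function $\xi=\varphi+i\psi$, holomorphic in $\mathcal F=\mathbf C\setminus\mathbf p(\mathcal S_0)$, such that $\xi(z)\to0$ and $\xi'(z)\to0$ as $|z|\to\infty$, and such that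 $\nabla\varphi=\overline{\xi'}$ extends continuously to $\overline{\mathcal F}$ with $\nabla\varphi\cdot\mathbf n=\mathbf v\cdot\mathbf n$ on $\partial\mathcal F$, $\mathbf n$ being the unit normal directed towards the exterior of $\mathcal F$. The solid of shape $\mathcal S_0$ is detectable if two configurations whose fluid potentials coincide near infinity are always equal. Theorem 1.3. For every integer $n\ge2$ there exist a shape $\mathcal S_0$ and $n$ configurations $(\mathbf p_j,\mathbf v_j)$, $j=0,\dots,n-1$, with $\mathbf p_j\ne\mathbf p_k$ for $j\ne k$, such that $\xi(z)=i/z^n$ is the fluid potential of the solid of shape $\mathcal S_0$ in each of the configurations $(\mathbf p_j,\mathbf v_j)$. In particular, the solid of shape $\mathcal S_0$ is not detectable. Moreover, these can be chosen so that for some real numbers $\omega>0$, $\delta>\rho>0$ and $\lambda$, with $s_j=\rho e^{2\pi i j/n}$, one has for every $j$: $\mathbf p_j=(2\pi j/n,\rho,s_j)$, that is $\mathbf p_jx=R(2\pi j/n)(x-s_0)+s_j$; $\mathbf v_j(x)=-\omega(x-s_j)^\perp$; and the boundary of the solid $\mathbf p_j(\mathcal S_0)$ is the part of the level set $\frac{\omega}{2}|x-s_j|^2-\cos(n\theta)r^{-n}-\lambda=0$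 lying in $|x-s_j|>\delta$, where $(r,\theta)$ are the polar coordinates of $x$. -/

import Mathlib

open scoped ContDiff Topology ComplexConjugate

noncomputable section

namespace RigidFluid

/-! The plane `ℝ²` is identified with `ℂ`; then `x^⊥ = (-x₂, x₁)` is `I * x`, and
`inner ℝ x y` is the Euclidean scalar product. -/

/-! ### Shapes -/

/-- `ρ` is a smooth local defining function of `S` at the point `x`: near `x`, the function `ρ` is
smooth and `S` is the set `{ρ ≤ 0}`; moreover `ρ x = 0` and `ρ` has nonzero differential at `x`. -/
structure IsDefiningFunctionAt (S : Set ℂ) (x : ℂ) (ρ : ℂ → ℝ) : Prop where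
  smooth : ∀ᶠ z in 𝓝 x, ContDiffAt ℝ ∞ ρ z
  zero : ρ x = 0
  grad_ne_zero : gradient ρ x ≠ 0
  mem_iff : ∀ᶠ z in 𝓝 x, (z ∈ S ↔ ρ z ≤ 0)

/-- The fluid domain surrounding a (closed) solid `S`. -/
def fluidDomain (S : Set ℂ) : Set ℂ := Sᶜ

/-- A shape: a compact simply connected subset of the plane with smooth boundary. The surrounding
fluid domain is connected. -/
structure IsShape (S : Set ℂ) : Prop where
  isCompact : IsCompact S
  isSimplyConnected : IsSimplyConnected S
  isConnected_fluidDomain : IsConnected (fluidDomain S)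
  smooth_boundary : ∀ x ∈ frontier S, ∃ ρ : ℂ → ℝ, IsDefiningFunctionAt S x ρ

/-- `ν` is the unit normal at the boundary point `x` of `S`, directed towards the exterior of the
fluid domain (that is, towards the interior of `S`). For a set with smooth boundary it exists and
does not depend on the defining function. -/
def IsUnitNormal (S : Set ℂ) (x ν : ℂ) : Prop :=
  ∃ ρ : ℂ → ℝ, IsDefiningFunctionAt S x ρ ∧ ν = -(‖gradient ρ x‖⁻¹ • gradient ρ x)

/-! ### Positions -/

/-- A triplet `(θ, s, r)` in `ℝ/2π × ℝ² × ℝ²`. -/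
structure Placement where
  angle : Real.Angle
  center : ℂ
  shift : ℂ

/-- The rigid displacement `x ↦ R(θ)(x - s) + r`. -/
def Placement.apply (p : Placement) (x : ℂ) : ℂ :=
  (p.angle.toCircle : ℂ) * (x - p.center) + p.shift

/-- Two triplets are equivalent for the shape `S₀` when the two displaced solids coincide. -/
def placementSetoid (S₀ : Set ℂ) : Setoid Placement where
  r p q := p.apply '' S₀ = q.apply '' S₀
  iseqv := ⟨fun _ => rfl, fun h => h.symm, fun h h' => h.trans h'⟩

/-- The set `𝒫` of positions of a solid of shape `S₀`. -/
def Position (S₀ : Set ℂ) : Type := Quotient (placementSetoid S₀)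

/-- The position represented by a triplet. -/
def Position.mk (S₀ : Set ℂ) (p : Placement) : Position S₀ := Quotient.mk (placementSetoid S₀) p

/-- The domain `p(S₀)` occupied by the solid of shape `S₀` in the position `p`. -/
def Position.solid {S₀ : Set ℂ} (p : Position S₀) : Set ℂ :=
  Quotient.lift (fun q : Placement => q.apply '' S₀) (fun _ _ h => h) p

/-! ### Rigid velocities and configurations -/

/-- A triplet `(ω, s, w)` in `ℝ × ℝ² × ℝ²`. -/
structure VelocityData where
  angular : ℝ
  center : ℂ
  translational : ℂ

/-- The rigid velocity field `x ↦ ω (x - s)^⊥ + w`. -/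
def VelocityData.field (v : VelocityData) (x : ℂ) : ℂ :=
  (v.angular : ℂ) * (Complex.I * (x - v.center)) + v.translational

/-- Two triplets are equivalent when they give the same velocity field. -/
def velocitySetoid : Setoid VelocityData where
  r v w := v.field = w.field
  iseqv := ⟨fun _ => rfl, fun h => h.symm, fun h h' => h.trans h'⟩

/-- The set `𝒱` of rigid velocities. -/
def RigidVelocity : Type := Quotient velocitySetoid

/-- The rigid velocity represented by a triplet. -/
def RigidVelocity.mk (v : VelocityData) : RigidVelocity := Quotient.mk velocitySetoid v

/-- The velocity field of a rigid velocity. -/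
def RigidVelocity.field (v : RigidVelocity) : ℂ → ℂ :=
  Quotient.lift VelocityData.field (fun _ _ h => h) v

/-- A configuration of a solid of shape `S₀`: a position and a rigid velocity. -/
structure Configuration (S₀ : Set ℂ) where
  position : Position S₀
  velocity : RigidVelocity

/-! ### The fluid -/

/-- `ξ = φ + iψ` is the holomorphic complex potential of the fluid around the solid `S` (with
smooth boundary) moving with the velocity field `v`. Here `∇φ = conj ξ'` is the fluid velocity;
`slip` says that it extends continuously to the closure of the fluid domain and that the extension
`u` satisfies `u · ν = v · ν`, that is `∂φ/∂ν = v · ν`, on the boundary of `S`. The values of `ξ`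
inside `S` are irrelevant. -/
structure IsComplexPotential (ξ : ℂ → ℂ) (S : Set ℂ) (v : ℂ → ℂ) : Prop where
  holomorphic : DifferentiableOn ℂ ξ (fluidDomain S)
  rest_at_infinity : Filter.Tendsto (deriv ξ) (Bornology.cobounded ℂ) (𝓝 0)
  vanish_at_infinity : Filter.Tendsto ξ (Bornology.cobounded ℂ) (𝓝 0)
  slip : ∃ u : ℂ → ℂ, ContinuousOn u (closure (fluidDomain S)) ∧
    (∀ z ∈ fluidDomain S, u z = conj (deriv ξ z)) ∧
    ∀ x ∈ frontier S, ∀ ν : ℂ, IsUnitNormal S x ν → inner ℝ (u x) ν = inner ℝ (v x) ν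

/-- `ξ` is the fluid potential for the solid of shape `S₀` in the configuration `c`. -/
def IsFluidPotential (ξ : ℂ → ℂ) {S₀ : Set ℂ} (c : Configuration S₀) : Prop :=
  IsComplexPotential ξ c.position.solid c.velocity.field

/-- The solid of shape `S₀` is detectable: the potential (known near infinity, which amounts to
knowing all the coefficients of its Laurent series there) determines the configuration. -/
def IsDetectable (S₀ : Set ℂ) : Prop :=
  ∀ (c₁ c₂ : Configuration S₀) (ξ₁ ξ₂ : ℂ → ℂ),
    IsFluidPotential ξ₁ c₁ → IsFluidPotential ξ₂ c₂ →
    (∀ᶠ z in Bornology.cobounded ℂ, ξ₁ z = ξ₂ z) → c₁ = c₂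

end RigidFluid

end

/-! The slip condition says that the fluid velocity minus the solid velocity is tangent to the
boundary, so the difference of their stream functions is locally constant there. For `ξ = i/zⁿ` the
fluid stream function is `Re z⁻ⁿ`, unchanged by rotations of angle `2π/n`, while the field `-n(x -
s)^⊥` contributes `n/2 |x - s|²`. A level curve of `levelFunction n s` thus bounds a solid
compatible with `ξ`. Letting `s` run over the `n`-th roots of unity gives congruent solids
(`image_mul_solidSet`) that are pairwise distinct (`solidSet_injective`). The level must give an
honest shape. Where `|z - s| ≥ 2` and `|s| = 1` one has `|z| ≥ 1`, so `z⁻ⁿ` is bounded by `1` and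
`n`-Lipschitz, and the quadratic term dominates. Hence the function increases along rays from `s`
(`levelFunction_lt`) and changes sign between radii `2` and `3`. -/

open Set Filter

namespace RigidFluid

/-! ### Uniqueness of the normal direction -/

section Normal

variable {E : Type*} [NormedAddCommGroup E] [InnerProductSpace ℝ E] [CompleteSpace E]

/-- If `{f ≤ 0} ⊆ {g ≤ 0}` near a common zero, every direction in which `f` strictly decreases is
one in which `g` does not increase. -/
theorem inner_gradient_nonpos {f g : E → ℝ} {a b x : E} (hf : HasGradientAt f a x)
    (hg : HasGradientAt g b x) (hfx : f x = 0) (hgx : g x = 0)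
    (h : ∀ᶠ z in 𝓝 x, f z ≤ 0 → g z ≤ 0) {w : E} (hw : inner ℝ a w < 0) :
    inner ℝ b w ≤ 0 := by
  by_contra! hb
  have h1 := (hf.hasFDerivAt.hasLineDerivAt w).tendsto_slope_zero_right
  have h2 := (hg.hasFDerivAt.hasLineDerivAt w).tendsto_slope_zero_right
  simp only [hfx, hgx, sub_zero, smul_eq_mul, InnerProductSpace.toDual_apply_apply] at h1 h2
  have h3 : Tendsto (fun t : ℝ => x + t • w) (𝓝[>] 0) (𝓝 x) := by
    have : Tendsto (fun t : ℝ => x + t • w) (𝓝 0) (𝓝 (x + (0 : ℝ) • w)) :=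
      Continuous.tendsto (by fun_prop) 0
    rw [zero_smul, add_zero] at this
    exact this.mono_left nhdsWithin_le_nhds
  obtain ⟨t, ht1, ht2, ht3, ht4⟩ := ((h1.eventually_lt_const hw).and
    ((h2.eventually_const_lt hb).and ((h3.eventually h).and self_mem_nhdsWithin))).exists
  have ht : 0 < t⁻¹ := inv_pos.2 ht4
  have hft : f (x + t • w) < 0 := by
    by_contra! hc
    exact ht1.not_ge (mul_nonneg ht.le hc)
  exact ht2.not_ge (mul_nonpos_of_nonneg_of_nonpos ht.le (ht3 hft.le))

/-- Two functions with the same sublevel set near a common zero have parallel gradients there. -/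
theorem inner_gradient_eq_zero {f g : E → ℝ} {a b x : E} (hf : HasGradientAt f a x)
    (hg : HasGradientAt g b x) (hfx : f x = 0) (hgx : g x = 0) (ha : a ≠ 0)
    (h : ∀ᶠ z in 𝓝 x, f z ≤ 0 → g z ≤ 0) {w : E} (hw : inner ℝ a w = 0) :
    inner ℝ b w = 0 := by
  have key : ∀ w : E, inner ℝ a w = 0 → inner ℝ b w ≤ 0 := by
    intro w hw
    have h1 : ∀ η : ℝ, 0 < η → inner ℝ b (w - η • a) ≤ 0 := fun η hη => by
      -- Tilting `w` by `-η a` makes `f` strictly decrease; letting `η` tend to `0` recovers `w`.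
      refine inner_gradient_nonpos hf hg hfx hgx h ?_
      rw [inner_sub_right, hw, inner_smul_right, zero_sub, neg_lt_zero]
      exact mul_pos hη (real_inner_self_pos.2 ha)
    have h2 : Tendsto (fun η : ℝ => inner ℝ b (w - η • a)) (𝓝[>] 0) (𝓝 (inner ℝ b w)) := by
      have : Tendsto (fun η : ℝ => inner ℝ b (w - η • a)) (𝓝 0)
          (𝓝 (inner ℝ b (w - (0 : ℝ) • a))) := Continuous.tendsto (by fun_prop) 0
      rw [zero_smul, sub_zero] at this
      exact this.mono_left nhdsWithin_le_nhds
    exact le_of_tendsto h2 (by filter_upwards [self_mem_nhdsWithin] with η hη using h1 η hη)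
  refine le_antisymm (key w hw) ?_
  have := key (-w) (by rw [inner_neg_right, hw, neg_zero])
  rw [inner_neg_right] at this
  linarith

end Normal

/-! ### The function defining the solid -/

/-- The function `n/2 |z - s|² - Re z⁻ⁿ - 3n`. -/
noncomputable def levelFunction (n : ℕ) (s z : ℂ) : ℝ :=
  n * ‖z - s‖ ^ 2 / 2 - (1 / z ^ n).re - 3 * n

/-- Its gradient away from the origin. -/
noncomputable def levelGradient (n : ℕ) (s z : ℂ) : ℂ :=
  n * (z - s) + conj (n / z ^ (n + 1))

theorem hasDerivAt_one_div_pow (n : ℕ) {z : ℂ} (hz : z ≠ 0) :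
    HasDerivAt (fun z : ℂ => 1 / z ^ n) (-(n / z ^ (n + 1))) z := by
  have h := (hasDerivAt_pow n z).inv (pow_ne_zero n hz)
  simp only [one_div]
  refine h.congr_deriv ?_
  rcases n with _ | n
  · simp
  · simp only [Nat.add_sub_cancel]
    field_simp
    ring

theorem hasGradientAt_re {f : ℂ → ℂ} {f' z : ℂ} (hf : HasDerivAt f f' z) :
    HasGradientAt (fun z => (f z).re) (conj f') z := by
  rw [hasGradientAt_iff_hasFDerivAt]
  have h := Complex.reCLM.hasFDerivAt.comp z (hf.hasFDerivAt.restrictScalars ℝ)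
  refine h.congr_fderiv ?_
  ext
  simp [Complex.inner]

theorem hasGradientAt_half_normSq (s z : ℂ) :
    HasGradientAt (fun z => ‖z - s‖ ^ 2 / 2) (z - s) z := by
  rw [hasGradientAt_iff_hasFDerivAt]
  have h := (((hasFDerivAt_id (𝕜 := ℝ) z).sub_const s).norm_sq).mul_const (1 / 2 : ℝ)
  refine (h.congr_fderiv ?_).congr_of_eventuallyEq (Eventually.of_forall fun w => ?_)
  · ext
    simp [Complex.inner]
  · simp [div_eq_mul_inv]

theorem hasGradientAt_levelFunction (n : ℕ) (s : ℂ) {z : ℂ} (hz : z ≠ 0) :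
    HasGradientAt (levelFunction n s) (levelGradient n s z) z := by
  rw [hasGradientAt_iff_hasFDerivAt]
  have h1 := (hasGradientAt_half_normSq s z).hasFDerivAt.const_mul (n : ℝ)
  have h2 := (hasGradientAt_re (hasDerivAt_one_div_pow n hz)).hasFDerivAt
  refine (((h1.sub h2).sub_const (3 * n : ℝ)).congr_fderiv ?_).congr_of_eventuallyEq
    (Eventually.of_forall fun w => ?_)
  · ext
    simp [levelGradient, Complex.inner]
    ring
  · simp only [levelFunction, Pi.sub_apply]
    ring

theorem contDiffAt_levelFunction (n : ℕ) (s : ℂ) {z : ℂ} (hz : z ≠ 0) :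
    ContDiffAt ℝ ∞ (levelFunction n s) z := by
  have h1 : ContDiffAt ℝ ∞ (fun z : ℂ => 1 / z ^ n) z := by
    simp only [one_div]
    exact (contDiffAt_id.pow n).inv (pow_ne_zero n hz)
  have h2 : ContDiffAt ℝ ∞ (fun z : ℂ => (1 / z ^ n).re) z :=
    Complex.reCLM.contDiff.contDiffAt.comp z h1
  have h3 : ContDiffAt ℝ ∞ (fun z : ℂ => ‖z - s‖ ^ 2) z :=
    (contDiffAt_id.sub contDiffAt_const).norm_sq ℝ
  exact (((contDiffAt_const.mul h3).div_const 2).sub h2).sub contDiffAt_const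

theorem continuousAt_levelFunction (n : ℕ) (s : ℂ) {z : ℂ} (hz : z ≠ 0) :
    ContinuousAt (levelFunction n s) z :=
  (contDiffAt_levelFunction n s hz).continuousAt

/-- Links the Cartesian form used in the estimates with the polar form of the theorem. -/
theorem re_one_div_pow (n : ℕ) {z : ℂ} (hz : z ≠ 0) :
    (1 / z ^ n).re = Real.cos (n * z.arg) / ‖z‖ ^ n := by
  have hr : ‖z‖ ≠ 0 := norm_ne_zero_iff.2 hz
  have h : (1 / z ^ n : ℂ) = ((‖z‖ ^ n)⁻¹ : ℝ) * Complex.exp ((-(n * z.arg) : ℝ) * Complex.I) := by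
    conv_lhs => rw [← Complex.norm_mul_exp_arg_mul_I z]
    rw [mul_pow, ← Complex.exp_nat_mul, one_div, mul_inv, ← Complex.exp_neg]
    push_cast
    congr 2
    ring
  rw [h, Complex.re_ofReal_mul, Complex.exp_ofReal_mul_I_re, Real.cos_neg]
  ring

/-! ### Estimates outside the disk of radius 2 -/

section Estimates

variable {s z : ℂ}

theorem one_le_norm (hs : ‖s‖ = 1) (hz : 2 ≤ ‖z - s‖) : 1 ≤ ‖z‖ := by
  have := norm_sub_le z s
  linarith

theorem ne_zero_of_two_le (hs : ‖s‖ = 1) (hz : 2 ≤ ‖z - s‖) : z ≠ 0 :=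
  norm_pos_iff.1 (one_pos.trans_le (one_le_norm hs hz))

theorem abs_re_one_div_pow_le (n : ℕ) (hz : 1 ≤ ‖z‖) : |(1 / z ^ n).re| ≤ 1 := by
  refine (Complex.abs_re_le_norm _).trans ?_
  rw [norm_div, norm_one, norm_pow]
  exact (div_le_one (by positivity)).2 (one_le_pow₀ hz)

theorem norm_pow_sub_pow_le (n : ℕ) {a b : ℂ} (ha : ‖a‖ ≤ 1) (hb : ‖b‖ ≤ 1) :
    ‖a ^ n - b ^ n‖ ≤ n * ‖a - b‖ := by
  induction n with
  | zero => simp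
  | succ n ih =>
    have : a ^ (n + 1) - b ^ (n + 1) = a ^ n * (a - b) + (a ^ n - b ^ n) * b := by ring
    rw [this]
    refine (norm_add_le _ _).trans ?_
    rw [norm_mul, norm_mul, norm_pow]
    have h1 : ‖a‖ ^ n * ‖a - b‖ ≤ 1 * ‖a - b‖ :=
      mul_le_mul_of_nonneg_right (pow_le_one₀ (norm_nonneg _) ha) (norm_nonneg _)
    have h2 : ‖a ^ n - b ^ n‖ * ‖b‖ ≤ ‖a ^ n - b ^ n‖ * 1 :=
      mul_le_mul_of_nonneg_left hb (norm_nonneg _)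
    push_cast
    linarith

/-- Inversion maps the exterior of the unit disk into the disk without increasing distances, and
powers are `n`-Lipschitz on the disk. No path inside the nonconvex exterior is needed. -/
theorem norm_one_div_pow_sub_le (n : ℕ) {w : ℂ} (hz : 1 ≤ ‖z‖) (hw : 1 ≤ ‖w‖) :
    ‖1 / z ^ n - 1 / w ^ n‖ ≤ n * ‖z - w‖ := by
  have hz0 : z ≠ 0 := norm_pos_iff.1 (one_pos.trans_le hz)
  have hw0 : w ≠ 0 := norm_pos_iff.1 (one_pos.trans_le hw)
  have h := norm_pow_sub_pow_le n (a := z⁻¹) (b := w⁻¹)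
    (by rw [norm_inv]; exact inv_le_one_of_one_le₀ hz)
    (by rw [norm_inv]; exact inv_le_one_of_one_le₀ hw)
  rw [inv_pow, inv_pow, inv_sub_inv hz0 hw0] at h
  rw [one_div, one_div]
  refine h.trans (mul_le_mul_of_nonneg_left ?_ n.cast_nonneg)
  rw [norm_div, norm_mul, norm_sub_rev w z]
  exact div_le_self (norm_nonneg _) (one_le_mul_of_one_le_of_one_le hz hw)

/-- `levelFunction` increases along the rays issued from `s`, outside the disk of radius `2`. -/
theorem levelFunction_lt {n : ℕ} (hn : 2 ≤ n) (hs : ‖s‖ = 1) {a : ℝ} (ha : 1 < a)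
    (hz : 2 ≤ ‖z - s‖) : levelFunction n s z < levelFunction n s (s + a * (z - s)) := by
  set w : ℂ := s + a * (z - s) with hw
  have hws : ‖w - s‖ = a * ‖z - s‖ := by
    rw [hw, add_sub_cancel_left, norm_mul, Complex.norm_real, Real.norm_of_nonneg (by linarith)]
  have hwz : ‖z - w‖ = (a - 1) * ‖z - s‖ := by
    have : z - w = ((1 - a : ℝ) : ℂ) * (z - s) := by rw [hw]; push_cast; ring
    rw [this, norm_mul, Complex.norm_real, Real.norm_eq_abs, abs_of_neg (by linarith), neg_sub]
  have hw2 : 2 ≤ ‖w - s‖ := by rw [hws]; nlinarith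
  have h := (Complex.abs_re_le_norm _).trans
    (norm_one_div_pow_sub_le n (one_le_norm hs hz) (one_le_norm hs hw2))
  rw [hwz, Complex.sub_re] at h
  have h1 := (abs_le.1 h).1
  unfold levelFunction
  rw [hws]
  have hn0 : (0 : ℝ) < n := by exact_mod_cast (by omega : 0 < n)
  set t := ‖z - s‖
  -- The gain `n(a² - 1)t²/2` of the quadratic term minus the Lipschitz loss `n(a - 1)t`.
  have h2 : 0 < n * ((a - 1) * t * ((a + 1) * t / 2 - 1)) := by
    refine mul_pos hn0 (mul_pos (mul_pos (by linarith) (by linarith)) ?_)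
    nlinarith
  nlinarith

/-- The level `3n` lies strictly between `2n + 1` and `9n/2 - 1`, the bounds at radii `2` and `3`.
-/
theorem levelFunction_neg {n : ℕ} (hn : 2 ≤ n) (hs : ‖s‖ = 1) (hz : ‖z - s‖ = 2) :
    levelFunction n s z < 0 := by
  have h := (abs_le.1 (abs_re_one_div_pow_le n (one_le_norm hs hz.ge))).1
  have hn' : (2 : ℝ) ≤ n := by exact_mod_cast hn
  unfold levelFunction
  rw [hz]
  linarith

theorem levelFunction_pos {n : ℕ} (hn : 2 ≤ n) (hs : ‖s‖ = 1) (hz : 3 ≤ ‖z - s‖) :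
    0 < levelFunction n s z := by
  have h := (abs_le.1 (abs_re_one_div_pow_le n (one_le_norm hs (by linarith : 2 ≤ ‖z - s‖)))).2
  have hn' : (2 : ℝ) ≤ n := by exact_mod_cast hn
  unfold levelFunction
  have : (9 : ℝ) ≤ ‖z - s‖ ^ 2 := by nlinarith
  nlinarith

/-- The two terms cannot cancel: one has norm at least `2n`, the other at most `n`. -/
theorem levelGradient_ne_zero {n : ℕ} (hn : 2 ≤ n) (hs : ‖s‖ = 1) (hz : 2 ≤ ‖z - s‖) :
    levelGradient n s z ≠ 0 := by
  intro h
  have h1 := congrArg norm (eq_neg_of_add_eq_zero_left h)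
  rw [norm_neg, norm_mul, RCLike.norm_conj, norm_div, Complex.norm_natCast, norm_pow] at h1
  have hn0 : (0 : ℝ) < n := by exact_mod_cast (by omega : 0 < n)
  have h2 : (n : ℝ) / ‖z‖ ^ (n + 1) ≤ n :=
    div_le_self hn0.le (one_le_pow₀ (one_le_norm hs hz))
  nlinarith

end Estimates

/-! ### The solid -/

/-- The disk of radius `2` around `s`, together with the sublevel set of `levelFunction`. -/
def solidSet (n : ℕ) (s : ℂ) : Set ℂ :=
  {z | ‖z - s‖ ≤ 2 ∨ levelFunction n s z ≤ 0}

theorem mem_fluidDomain_solidSet {n : ℕ} {s z : ℂ} :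
    z ∈ fluidDomain (solidSet n s) ↔ 2 < ‖z - s‖ ∧ 0 < levelFunction n s z := by
  simp [fluidDomain, solidSet]

section Solid

variable {n : ℕ} {s : ℂ}

theorem eventually_two_lt {z : ℂ} (hz : 2 < ‖z - s‖) : ∀ᶠ w in 𝓝 z, 2 < ‖w - s‖ :=
  (by fun_prop : Continuous fun w : ℂ => ‖w - s‖).continuousAt.eventually_const_lt hz

theorem isOpen_fluidDomain_solidSet (hs : ‖s‖ = 1) : IsOpen (fluidDomain (solidSet n s)) := by
  rw [isOpen_iff_mem_nhds]
  intro z hz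
  rw [mem_fluidDomain_solidSet] at hz
  filter_upwards [eventually_two_lt hz.1, (continuousAt_levelFunction n s
    (ne_zero_of_two_le hs hz.1.le)).eventually_const_lt hz.2] with w h1 h2
  exact mem_fluidDomain_solidSet.2 ⟨h1, h2⟩

theorem isClosed_solidSet (hs : ‖s‖ = 1) : IsClosed (solidSet n s) :=
  ⟨isOpen_fluidDomain_solidSet hs⟩

theorem isCompact_solidSet (hn : 2 ≤ n) (hs : ‖s‖ = 1) : IsCompact (solidSet n s) := by
  refine (isCompact_closedBall s 3).of_isClosed_subset (isClosed_solidSet hs) fun z hz => ?_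
  rw [mem_closedBall_iff_norm]
  by_contra! h
  rcases hz with hz | hz
  · linarith
  · exact hz.not_gt (levelFunction_pos hn hs h.le)

theorem mem_fluidDomain_of_three_le (hn : 2 ≤ n) (hs : ‖s‖ = 1) {z : ℂ} (hz : 3 ≤ ‖z - s‖) :
    z ∈ fluidDomain (solidSet n s) :=
  mem_fluidDomain_solidSet.2 ⟨by linarith, levelFunction_pos hn hs hz⟩

theorem dilation_mem_fluidDomain (hn : 2 ≤ n) (hs : ‖s‖ = 1) {z : ℂ}
    (hz : 2 ≤ ‖z - s‖) (hz' : 0 ≤ levelFunction n s z) {a : ℝ} (ha : 1 < a) :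
    s + a * (z - s) ∈ fluidDomain (solidSet n s) := by
  refine mem_fluidDomain_solidSet.2 ⟨?_, hz'.trans_lt (levelFunction_lt hn hs ha hz)⟩
  rw [add_sub_cancel_left, norm_mul, Complex.norm_real, Real.norm_of_nonneg (by linarith)]
  nlinarith

theorem starConvex_solidSet (hn : 2 ≤ n) (hs : ‖s‖ = 1) : StarConvex ℝ s (solidSet n s) := by
  rw [starConvex_iff_forall_pos (by simp [solidSet])]
  intro z hz a b ha hb hab
  by_contra hw
  -- Were the intermediate point in the fluid, dilating it by `b⁻¹` about `s` would put `z` in the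
  -- fluid.
  have hb1 : 1 < b⁻¹ := (one_lt_inv₀ hb).2 (by linarith)
  obtain ⟨h1, h2⟩ := mem_fluidDomain_solidSet.1 hw
  have h := dilation_mem_fluidDomain hn hs h1.le h2.le hb1
  have hz' : s + (b⁻¹ : ℝ) * (a • s + b • z - s) = z := by
    have hbc : (b : ℂ) ≠ 0 := by exact_mod_cast hb.ne'
    obtain rfl : a = 1 - b := by linarith
    simp only [Complex.real_smul]
    push_cast
    field_simp
    ring
  rw [hz'] at h
  exact h hz

theorem isSimplyConnected_solidSet (hn : 2 ≤ n) (hs : ‖s‖ = 1) :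
    IsSimplyConnected (solidSet n s) := by
  have := (starConvex_solidSet hn hs).contractibleSpace ⟨s, by simp [solidSet]⟩
  exact SimplyConnectedSpace.ofContractible (solidSet n s)

/-- Each fluid point is joined radially to the circle of radius `3`, which lies in the fluid. -/
theorem isConnected_fluidDomain_solidSet (hn : 2 ≤ n) (hs : ‖s‖ = 1) :
    IsConnected (fluidDomain (solidSet n s)) := by
  have hsph := isPathConnected_sphere (by rw [Complex.rank_real_complex]; norm_num) s
    (by norm_num : (0 : ℝ) ≤ 3)
  have hsub : Metric.sphere s 3 ⊆ fluidDomain (solidSet n s) := fun z hz =>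
    mem_fluidDomain_of_three_le hn hs (mem_sphere_iff_norm.1 hz).ge
  obtain ⟨x, hx, hjoin⟩ := hsph
  refine IsPathConnected.isConnected ⟨x, hsub hx, fun {z} hz => ?_⟩
  obtain ⟨h1, h2⟩ := mem_fluidDomain_solidSet.1 hz
  set t := ‖z - s‖ with ht
  have hdil : ∀ c : ℝ, 0 ≤ c → ‖s + c * (z - s) - s‖ = c * t := fun c hc => by
    rw [add_sub_cancel_left, norm_mul, Complex.norm_real, Real.norm_of_nonneg hc]
  have ht0 : 0 < t := by linarith
  have hy : s + (3 / t : ℝ) * (z - s) ∈ Metric.sphere s 3 := by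
    rw [mem_sphere_iff_norm, hdil _ (by positivity), div_mul_cancel₀ _ ht0.ne']
  refine ((hjoin hy).mono hsub).trans (JoinedIn.of_segment_subset ?_)
  rintro _ ⟨a, b, ha, hb, hab, rfl⟩
  have hc : a • (s + (3 / t : ℝ) * (z - s)) + b • z = s + ((a * (3 / t) + b : ℝ) : ℂ) * (z - s) := by
    obtain rfl : b = 1 - a := by linarith
    simp only [Complex.real_smul]
    push_cast
    ring
  rw [hc]
  rcases lt_trichotomy 1 (a * (3 / t) + b) with h | h | h
  · exact dilation_mem_fluidDomain hn hs h1.le h2.le h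
  · rw [← h]
    simpa using hz
  · refine mem_fluidDomain_of_three_le hn hs ?_
    rw [hdil _ (by positivity)]
    have h3 : (a * (3 / t) + b) * t = 3 * a + b * t := by field_simp
    rw [h3]
    -- If the radius `3a + bt` were below `3`, then `t < 3`, so moving towards the circle would be a
    -- dilation of factor at least `1`.
    by_contra! h4
    have : 1 * t ≤ 3 := by nlinarith
    have : t < 3 := by nlinarith
    have : t ≤ (a * (3 / t) + b) * t := by rw [h3]; nlinarith
    nlinarith

theorem frontier_solidSet (hn : 2 ≤ n) (hs : ‖s‖ = 1) :
    frontier (solidSet n s) = {z | 2 < ‖z - s‖ ∧ levelFunction n s z = 0} := by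
  ext z
  constructor
  · intro hz
    have hzS := (isClosed_solidSet hs).frontier_subset hz
    have hlev : 2 ≤ ‖z - s‖ → ¬ levelFunction n s z < 0 := fun h2 h => by
      refine hz.2 (mem_interior_iff_mem_nhds.2 ?_)
      filter_upwards [(continuousAt_levelFunction n s
        (ne_zero_of_two_le hs h2)).eventually_lt_const h] with w hw using Or.inr hw.le
    have h2 : 2 < ‖z - s‖ := by
      by_contra! h
      rcases h.lt_or_eq with h | h
      · refine hz.2 (mem_interior_iff_mem_nhds.2 ?_)
        filter_upwards [(by fun_prop : Continuous fun w : ℂ =>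
          ‖w - s‖).continuousAt.eventually_lt_const h] with w hw using Or.inl hw.le
      · exact hlev h.ge (levelFunction_neg hn hs h)
    exact ⟨h2, le_antisymm (hzS.resolve_left h2.not_ge) (not_lt.1 (hlev h2.le))⟩
  · rintro ⟨h2, h0⟩
    rw [frontier_eq_closure_inter_closure]
    refine ⟨subset_closure (Or.inr h0.le), ?_⟩
    -- Small dilations of `z` are fluid points, so `z` is not interior to the solid.
    have hlim : Tendsto (fun a : ℝ => s + a * (z - s)) (𝓝[>] 1) (𝓝 z) := by
      have : Tendsto (fun a : ℝ => s + a * (z - s)) (𝓝 1) (𝓝 (s + (1 : ℝ) * (z - s))) :=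
        Continuous.tendsto (by fun_prop) 1
      rw [Complex.ofReal_one, one_mul, add_sub_cancel] at this
      exact this.mono_left nhdsWithin_le_nhds
    refine mem_closure_of_tendsto hlim ?_
    filter_upwards [self_mem_nhdsWithin] with a ha
    exact dilation_mem_fluidDomain hn hs h2.le h0.ge ha

/-- Every ray issued from `s` meets the boundary of the solid. -/
theorem exists_mem_frontier_on_ray (hn : 2 ≤ n) (hs : ‖s‖ = 1) {e : ℂ} (he : ‖e‖ = 1) :
    ∃ t : ℝ, 0 < t ∧ s + t * e ∈ frontier (solidSet n s) := by
  have hnorm : ∀ t : ℝ, 2 ≤ t → ‖s + t * e - s‖ = t := fun t ht => by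
    rw [add_sub_cancel_left, norm_mul, Complex.norm_real, he, mul_one,
      Real.norm_of_nonneg (by linarith)]
  have hcont : ContinuousOn (fun t : ℝ => levelFunction n s (s + t * e)) (Icc 2 3) := by
    intro t ht
    exact ((continuousAt_levelFunction n s (ne_zero_of_two_le hs
      (by rw [hnorm t ht.1]; exact ht.1))).comp (f := fun t : ℝ => s + t * e) (by fun_prop)).continuousWithinAt
  obtain ⟨t, ht, h0⟩ := intermediate_value_Icc (by norm_num : (2 : ℝ) ≤ 3) hcont
    ⟨(levelFunction_neg hn hs (hnorm 2 le_rfl)).le,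
      (levelFunction_pos hn hs (hnorm 3 (by norm_num)).ge).le⟩
  refine ⟨t, by linarith [ht.1], ?_⟩
  rw [frontier_solidSet hn hs]
  refine ⟨?_, h0⟩
  rw [hnorm t ht.1]
  refine ht.1.lt_of_ne ?_
  rintro rfl
  exact (levelFunction_neg hn hs (hnorm 2 le_rfl)).ne h0

theorem isDefiningFunctionAt_levelFunction (hn : 2 ≤ n) (hs : ‖s‖ = 1) {x : ℂ}
    (hx : x ∈ frontier (solidSet n s)) :
    IsDefiningFunctionAt (solidSet n s) x (levelFunction n s) := by
  rw [frontier_solidSet hn hs] at hx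
  have hx0 := ne_zero_of_two_le hs hx.1.le
  refine ⟨?_, hx.2, ?_, ?_⟩
  · filter_upwards [eventually_ne_nhds hx0] with z hz using contDiffAt_levelFunction n s hz
  · rw [(hasGradientAt_levelFunction n s hx0).gradient]
    exact levelGradient_ne_zero hn hs hx.1.le
  · filter_upwards [eventually_two_lt hx.1] with z hz
    exact ⟨fun h => h.resolve_left hz.not_ge, Or.inr⟩

theorem isShape_solidSet (hn : 2 ≤ n) (hs : ‖s‖ = 1) : IsShape (solidSet n s) where
  isCompact := isCompact_solidSet hn hs
  isSimplyConnected := isSimplyConnected_solidSet hn hs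
  isConnected_fluidDomain := isConnected_fluidDomain_solidSet hn hs
  smooth_boundary _ hx := ⟨_, isDefiningFunctionAt_levelFunction hn hs hx⟩

/-! ### Distinctness and congruence of the solids -/

/-- Two such solids with distinct centres are distinct: their boundaries would be equidistant from
the centres. -/
theorem solidSet_injective (hn : 2 ≤ n) {s' : ℂ} (hs : ‖s‖ = 1) (hs' : ‖s'‖ = 1)
    (h : solidSet n s = solidSet n s') : s = s' := by
  by_contra hne
  have hd : 0 < ‖s - s'‖ := norm_pos_iff.2 (sub_ne_zero.2 hne)
  have hdc : (‖s - s'‖ : ℂ) ≠ 0 := by exact_mod_cast hd.ne'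
  -- On the ray from `s` pointing away from `s'`, the distance to `s'` exceeds that to `s` by `‖s -
  -- s'‖`.
  obtain ⟨t, ht, hmem⟩ := exists_mem_frontier_on_ray hn hs (e := (s - s') / ‖s - s'‖)
    (by rw [norm_div, Complex.norm_real, norm_norm, div_self hd.ne'])
  set z := s + t * ((s - s') / ‖s - s'‖) with hz
  have hmem' := hmem
  rw [h, frontier_solidSet hn hs'] at hmem'
  rw [frontier_solidSet hn hs] at hmem
  have heq := hmem.2.trans hmem'.2.symm
  have h1 : ‖z - s‖ = t := by
    rw [hz, add_sub_cancel_left, norm_mul, norm_div, Complex.norm_real, Complex.norm_real,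
      norm_norm, div_self hd.ne', mul_one, Real.norm_of_nonneg ht.le]
  have h2 : ‖z - s'‖ = t + ‖s - s'‖ := by
    have : z - s' = ((t + ‖s - s'‖ : ℝ) : ℂ) * ((s - s') / ‖s - s'‖) := by
      rw [hz]
      push_cast
      field_simp
      ring
    rw [this, norm_mul, norm_div, Complex.norm_real, Complex.norm_real, norm_norm,
      div_self hd.ne', mul_one, Real.norm_of_nonneg (by linarith)]
  unfold levelFunction at heq
  rw [h1, h2] at heq
  have hn0 : (0 : ℝ) < n := by exact_mod_cast (by omega : 0 < n)
  have h3 : 0 < n * (‖s - s'‖ * (2 * t + ‖s - s'‖)) := by positivity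
  nlinarith

theorem levelFunction_mul (hs : ‖s‖ = 1) (hsn : s ^ n = 1) (z : ℂ) :
    levelFunction n s (s * z) = levelFunction n 1 z := by
  have : s * z - s = s * (z - 1) := by ring
  rw [levelFunction, levelFunction, this, norm_mul, hs, one_mul, mul_pow, hsn, one_mul]

/-- The rotations of order dividing `n` permute the solids. -/
theorem image_mul_solidSet (hs : ‖s‖ = 1) (hsn : s ^ n = 1) :
    (fun z => s * z) '' solidSet n 1 = solidSet n s := by
  have hs0 : s ≠ 0 := norm_pos_iff.1 (by rw [hs]; exact one_pos)
  have key : ∀ z, s * z ∈ solidSet n s ↔ z ∈ solidSet n 1 := fun z => by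
    have : s * z - s = s * (z - 1) := by ring
    simp only [solidSet, mem_ofPred_eq, levelFunction_mul hs hsn, this, norm_mul, hs, one_mul]
  ext z
  constructor
  · rintro ⟨w, hw, rfl⟩
    exact (key w).2 hw
  · intro hz
    have hzs : s * (z / s) = z := mul_div_cancel₀ z hs0
    exact ⟨z / s, (key _).1 (by rwa [hzs]), hzs⟩

/-! ### The potential -/

theorem hasDerivAt_potential (n : ℕ) {z : ℂ} (hz : z ≠ 0) :
    HasDerivAt (fun z : ℂ => Complex.I / z ^ n) (Complex.I * -(n / z ^ (n + 1))) z := by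
  refine ((hasDerivAt_one_div_pow n hz).const_mul Complex.I).congr_of_eventuallyEq
    (Eventually.of_forall fun w => ?_)
  simp [div_eq_mul_inv]

theorem tendsto_const_div_pow_cobounded (c : ℂ) {m : ℕ} (hm : m ≠ 0) :
    Tendsto (fun z : ℂ => c / z ^ m) (Bornology.cobounded ℂ) (𝓝 0) := by
  have h := ((tendsto_inv₀_cobounded (α := ℂ)).pow m).const_mul c
  simpa [hm, div_eq_mul_inv] using h

theorem isComplexPotential_solidSet (hn : 2 ≤ n) (hs : ‖s‖ = 1) :
    IsComplexPotential (fun z : ℂ => Complex.I / z ^ n) (solidSet n s)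
      (VelocityData.field { angular := -n, center := s, translational := 0 }) where
  holomorphic z hz := (hasDerivAt_potential n (ne_zero_of_two_le hs
    (mem_fluidDomain_solidSet.1 hz).1.le)).differentiableAt.differentiableWithinAt
  rest_at_infinity := by
    have h := (tendsto_const_div_pow_cobounded (n : ℂ) n.succ_ne_zero).neg.const_mul Complex.I
    rw [neg_zero, mul_zero] at h
    refine h.congr' ?_
    filter_upwards [Bornology.eventually_ne_cobounded (0 : ℂ)] with z hz
    exact (hasDerivAt_potential n hz).deriv.symm
  vanish_at_infinity := tendsto_const_div_pow_cobounded _ (by omega)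
  slip := by
    refine ⟨fun z => conj (Complex.I * -(n / z ^ (n + 1))), ?_, ?_, ?_⟩
    · intro z hz
      have hz2 : 2 ≤ ‖z - s‖ := by
        have hcl : IsClosed {z : ℂ | 2 ≤ ‖z - s‖} := isClosed_le (by fun_prop) (by fun_prop)
        exact hcl.closure_subset_iff.2 (fun w hw => (mem_fluidDomain_solidSet.1 hw).1.le) hz
      have hz0 := pow_ne_zero (n + 1) (ne_zero_of_two_le hs hz2)
      refine ContinuousAt.continuousWithinAt ?_
      exact Complex.continuous_conj.continuousAt.comp
        (continuousAt_const.mul (continuousAt_const.div (continuousAt_id.pow _) hz0).neg)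
    · intro z hz
      rw [(hasDerivAt_potential n (ne_zero_of_two_le hs
        (mem_fluidDomain_solidSet.1 hz).1.le)).deriv]
    · rintro x hx _ ⟨f, hf, rfl⟩
      have hlev := isDefiningFunctionAt_levelFunction hn hs hx
      have hx0 : x ≠ 0 := by
        rw [frontier_solidSet hn hs] at hx
        exact ne_zero_of_two_le hs hx.1.le
      have hgf : HasGradientAt f (gradient f x) x :=
        (hf.smooth.self_of_nhds.differentiableAt (by simp)).hasGradientAt
      have hgl := hasGradientAt_levelFunction n s hx0
      have hsub : ∀ᶠ z in 𝓝 x, levelFunction n s z ≤ 0 → f z ≤ 0 := by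
        filter_upwards [hf.mem_iff, hlev.mem_iff] with z h1 h2 h3
        exact h1.1 (h2.2 h3)
      -- The relative velocity `u - v` is exactly `I * levelGradient n s x`, hence tangent to the
      -- level curve; parallelism of gradients carries this over to the arbitrary defining function
      -- `f`.
      have hperp : inner ℝ (levelGradient n s x) (Complex.I * levelGradient n s x) = 0 := by
        simp [Complex.inner]
        ring
      have h0 := inner_gradient_eq_zero hgl hgf hlev.zero hf.zero
        (hgl.gradient ▸ hlev.grad_ne_zero) hsub hperp
      rw [inner_neg_right, inner_neg_right, inner_smul_right, inner_smul_right, neg_inj]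
      congr 1
      rw [← sub_eq_zero, ← inner_sub_left, real_inner_comm]
      convert! h0 using 2
      simp only [VelocityData.field, levelGradient, map_mul, map_neg, Complex.conj_I]
      push_cast
      ring

end Solid

end RigidFluid

/-! ### The configurations -/

open RigidFluid

theorem theorem1p3 (n : ℕ) (hn : 2 ≤ n) :
    ∃ (S₀ : Set ℂ) (c : Fin n → RigidFluid.Configuration S₀),
      RigidFluid.IsShape S₀ ∧
      (∀ j k : Fin n, j ≠ k → (c j).position ≠ (c k).position) ∧
      (∀ j : Fin n, RigidFluid.IsFluidPotential (fun z : ℂ => Complex.I / z ^ n) (c j)) ∧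
      ¬ RigidFluid.IsDetectable S₀ ∧
      ∃ (om ρ δ lam : ℝ) (s : Fin n → ℂ), 0 < om ∧ 0 < ρ ∧ ρ < δ ∧
        ∀ j : Fin n,
          s j = (ρ : ℂ) * Complex.exp (2 * Real.pi * Complex.I * (j : ℕ) / n) ∧
          (c j).position = RigidFluid.Position.mk S₀
            { angle := ((2 * Real.pi * (j : ℕ) / n : ℝ) : Real.Angle)
              center := (ρ : ℂ)
              shift := s j } ∧
          (c j).velocity = RigidFluid.RigidVelocity.mk
            { angular := -om, center := s j, translational := 0 } ∧
          frontier (c j).position.solid =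
            {z : ℂ | δ < ‖z - s j‖ ∧
              om * ‖z - s j‖ ^ 2 / 2 - Real.cos (n * z.arg) / ‖z‖ ^ n - lam = 0} := by
  set s : Fin n → ℂ := fun j => Complex.exp (2 * Real.pi * Complex.I * (j : ℕ) / n) with hsdef
  have hexp : ∀ j, s j = Complex.exp ((2 * Real.pi * (j : ℕ) / n : ℝ) * Complex.I) := fun j => by
    simp only [hsdef]
    push_cast
    ring_nf
  have hs : ∀ j, ‖s j‖ = 1 := fun j => by rw [hexp, Complex.norm_exp_ofReal_mul_I]
  have hprim := Complex.isPrimitiveRoot_exp n (by omega)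
  have hspow : ∀ j : Fin n, s j = Complex.exp (2 * Real.pi * Complex.I / n) ^ (j : ℕ) := fun j => by
    rw [← Complex.exp_nat_mul]
    simp only [hsdef]
    ring_nf
  have hsn : ∀ j, s j ^ n = 1 := fun j => by
    rw [hspow, pow_right_comm, hprim.pow_eq_one, one_pow]
  have hsinj : Function.Injective s := fun j k hjk => by
    rw [hspow, hspow] at hjk
    exact Fin.ext (hprim.pow_inj j.2 k.2 hjk)
  let place : Fin n → Placement := fun j =>
    { angle := ((2 * Real.pi * (j : ℕ) / n : ℝ) : Real.Angle)
      center := ((1 : ℝ) : ℂ)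
      shift := s j }
  let c : Fin n → Configuration (solidSet n 1) := fun j =>
    { position := Position.mk _ (place j)
      velocity := RigidVelocity.mk { angular := -n, center := s j, translational := 0 } }
  have hsolid : ∀ j, (c j).position.solid = solidSet n (s j) := fun j => by
    change (place j).apply '' solidSet n 1 = _
    rw [← image_mul_solidSet (hs j) (hsn j)]
    congr 1
    funext z
    -- The rotation factor equals `s j`, so `s j * (z - 1) + s j = s j * z`: the displacement is a
    -- rotation about the origin.
    simp only [Placement.apply, place, Real.Angle.toCircle_coe, Circle.coe_exp, ← hexp]
    push_cast
    ring
  have hpos : ∀ j k : Fin n, j ≠ k → (c j).position ≠ (c k).position := fun j k hjk h => by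
    have h1 := congrArg Position.solid h
    rw [hsolid, hsolid] at h1
    exact hjk (hsinj (solidSet_injective hn (hs j) (hs k) h1))
  have hpot : ∀ j : Fin n, IsFluidPotential (fun z : ℂ => Complex.I / z ^ n) (c j) := fun j => by
    unfold IsFluidPotential
    rw [hsolid]
    exact isComplexPotential_solidSet hn (hs j)
  refine ⟨solidSet n 1, c, isShape_solidSet hn norm_one, hpos, hpot, fun hdet => ?_,
    n, 1, 2, 3 * n, s, by exact_mod_cast (by omega : 0 < n), one_pos, one_lt_two, fun j =>
      ⟨by simp [hsdef], rfl, rfl, ?_⟩⟩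
  · have h := hdet (c ⟨0, by omega⟩) (c ⟨1, by omega⟩) _ _ (hpot _) (hpot _)
      (Eventually.of_forall fun _ => rfl)
    exact hpos _ _ (by simp) (congrArg Configuration.position h)
  · rw [hsolid, frontier_solidSet hn (hs j)]
    ext z
    refine and_congr_right fun hz => ?_
    rw [levelFunction, re_one_div_pow n (ne_zero_of_two_le (hs j) hz.le)]
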